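/- Let $\mathcal C$ be a small non-empty category. Assume that $\mathcal C$ has the amalgamation property (any two arrows $b \leftarrow a \to c$ with common domain can be completed to a commutative square) and the joint embedding property (for any objects $a,b$ there are an object $c$ and arrows $a\to c$, $b\to c$). Let $u$ be an object of the ind-completion $\mathrm{Ind}\text{-}\mathcal C$, in which $\mathcal C$ is regarded as a full subcategory, such that * $u$ is $\mathcal C$-universal: for every $c\in\mathcal C$ there is an arrow $c\to u$; * $u$ is $\mathcal C$-ultrahomogeneous: for every arrow $j:a\to b$ of $\mathcal C$ and all arrows $\chi_1:a\to u$, $\chi_2:b\to u$ there is an automorphism $e$ of $u$ with $e\circ\chi_1=\chi_2\circ j$. For an arrow $\chi:c\to u$ with $c\in\mathcal C$ put $\mathcal I_\chi=\{f:u\cong u \mid f\circ\chi=\chi\}$. Then: 1. The collection of all the subgroups $\mathcal I_\chi$ is an algebraic base for the group of automorphisms of $u$ in $\mathrm{Ind}\text{-}\mathcal C$: it is non-empty, the intersection of any two members contains a member, and every conjugate of a member is a member. It is therefore a basis of neighbourhoods of the identity for a unique group topology; let $\mathrm{Aut}_{\mathcal C}(u)$ be the resulting topological group. 2. For every $c\in\mathcal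 C$, the set $F(c)=\mathrm{Hom}_{\mathrm{Ind}\text{-}\mathcal C}(c,u)$ with the action $g\cdot\chi=g\circ\chi$ is a non-empty, transitive and continuous $\mathrm{Aut}_{\mathcal C}(u)$-set, and, with $F(f)=(-\circ f):\mathrm{Hom}_{\mathrm{Ind}\text{-}\mathcal C}(d,u)\to\mathrm{Hom}_{\mathrm{Ind}\text{-}\mathcal C}(c,u)$ for $f:c\to d$ in $\mathcal C$, this defines a functor $F:\mathcal C^{\mathrm{op}}\to\mathbf{Cont}(\mathrm{Aut}_{\mathcal C}(u))$, where $\mathbf{Cont}(G)$ is the category of continuous left actions of $G$ on discrete sets and equivariant maps. 3. Let $J_{at}$ be the atomic topology on $\mathcal C^{\mathrm{op}}$ (the covering sieves are the non-empty ones). The functor $F$ induces an equivalence of toposes $$\mathbf{Sh}(\mathcal C^{\mathrm{op}},J_{at})\simeq\mathbf{Cont}(\mathrm{Aut}_{\mathcal C}(u)),$$ that is, there is an equivalence whose composite with the canonical functor $\mathcal C^{\mathrm{op}}\to\mathbf{Sh}(\mathcal C^{\mathrm{op}},J_{at})$ (the Yoneda embedding followed by sheafification) is naturally isomorphic to $F$.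 -/

import Mathlib

open CategoryTheory Opposite

universe v w u₁ u₂

namespace GaloisTopos

/-! ### Algebraic bases and the topology they generate -/

section AlgebraicBase

variable {G : Type w} [Group G]

/-- A collection `B` of subgroups of `G` is an algebraic base if it is a filter base of
neighbourhoods of `1` (it is non-empty and the intersection of two members contains a member) and
it is closed under conjugation. See `IsAlgebraicBase.hasBasis_nhds_one` and
`IsAlgebraicBase.isTopologicalGroup` for the group topology having `B` as a basis of neighbourhoods
of the identity. -/
structure IsAlgebraicBase (B : Set (Subgroup G)) : Prop where
  nonempty : B.Nonempty
  inter : ∀ U ∈ B, ∀ V ∈ B, ∃ W ∈ B, W ≤ U ⊓ V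
  conj : ∀ U ∈ B, ∀ g : G, U.map (MulAut.conj g).toMonoidHom ∈ B

/-- The group filter basis consisting of the members of an algebraic base. -/
@[reducible]
def IsAlgebraicBase.groupFilterBasis {B : Set (Subgroup G)} (hB : IsAlgebraicBase B) :
    GroupFilterBasis G where
  sets := {s | ∃ U ∈ B, s = (U : Set G)}
  nonempty := by
    obtain ⟨U, hU⟩ := hB.nonempty
    exact ⟨_, U, hU, rfl⟩
  inter_sets := by
    rintro _ _ ⟨U, hU, rfl⟩ ⟨V, hV, rfl⟩
    obtain ⟨W, hW, h⟩ := hB.inter U hU V hV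
    exact ⟨_, ⟨W, hW, rfl⟩, h⟩
  one' := by
    rintro _ ⟨U, hU, rfl⟩
    exact U.one_mem
  mul' := by
    rintro _ ⟨U, hU, rfl⟩
    refine ⟨_, ⟨U, hU, rfl⟩, ?_⟩
    rintro _ ⟨a, ha, b, hb, rfl⟩
    exact U.mul_mem ha hb
  inv' := by
    rintro _ ⟨U, hU, rfl⟩
    exact ⟨_, ⟨U, hU, rfl⟩, fun a ha => U.inv_mem ha⟩
  conj' := by
    rintro g _ ⟨U, hU, rfl⟩
    refine ⟨_, ⟨_, hB.conj U hU g⁻¹, rfl⟩, ?_⟩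
    rintro _ ⟨a, ha, rfl⟩
    have h : g * (g⁻¹ * a * g) * g⁻¹ = a := by group
    simpa [h] using ha

/-- The topology on `G` generated by an algebraic base: the neighbourhoods of `g` are the sets
containing a coset `g U` with `U` in the base. -/
@[reducible]
def IsAlgebraicBase.topology {B : Set (Subgroup G)} (hB : IsAlgebraicBase B) :
    TopologicalSpace G :=
  hB.groupFilterBasis.topology

theorem IsAlgebraicBase.isTopologicalGroup {B : Set (Subgroup G)} (hB : IsAlgebraicBase B) :
    @IsTopologicalGroup G hB.topology _ :=
  hB.groupFilterBasis.isTopologicalGroup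

theorem IsAlgebraicBase.hasBasis_nhds_one {B : Set (Subgroup G)} (hB : IsAlgebraicBase B) :
    (@nhds G hB.topology 1).HasBasis (fun U : Subgroup G => U ∈ B) (fun U => (U : Set G)) := by
  refine ⟨fun s => ?_⟩
  rw [hB.groupFilterBasis.nhds_one_hasBasis.mem_iff]
  constructor
  · rintro ⟨_, ⟨U, hU, rfl⟩, h⟩
    exact ⟨U, hU, h⟩
  · rintro ⟨U, hU, h⟩
    exact ⟨_, ⟨U, hU, rfl⟩, h⟩

theorem IsAlgebraicBase.isOpen {B : Set (Subgroup G)} (hB : IsAlgebraicBase B)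
    {U : Subgroup G} (hU : U ∈ B) : @IsOpen G hB.topology (U : Set G) := by
  let := hB.topology
  have := hB.isTopologicalGroup
  exact U.isOpen_of_mem_nhds (g := 1) (hB.hasBasis_nhds_one.mem_of_mem hU)

end AlgebraicBase

/-! ### The topos of continuous actions of a topological group -/

section Cont

variable (G : Type w) [Group G] [TopologicalSpace G]

/-- A left action of `G` on a set `X` is continuous if the map `G × X → X` is continuous, where
`X` carries the discrete topology. -/
def IsContinuousAction : ObjectProperty (Action (Type w) G) := fun X =>
  letI : TopologicalSpace X.V := ⊥
  Continuous fun p : G × X.V => X.ρ p.1 p.2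

/-- The category of continuous actions of `G` on discrete sets and `G`-equivariant maps. -/
abbrev Cont : Type (w + 1) := (IsContinuousAction G).FullSubcategory

variable {G}

/-- The non-empty transitive actions. -/
def IsTransitiveAction (X : Action (Type w) G) : Prop :=
  Nonempty X.V ∧ ∀ x y : X.V, ∃ g : G, X.ρ g x = y

theorem isContinuousAction_iff [IsTopologicalGroup G] (X : Action (Type w) G) :
    IsContinuousAction G X ↔ ∀ x : X.V, IsOpen {g : G | X.ρ g x = x} := by
  let : TopologicalSpace X.V := ⊥
  have : DiscreteTopology X.V := ⟨rfl⟩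
  change (Continuous fun p : G × X.V => X.ρ p.1 p.2) ↔ _
  rw [continuous_prod_of_discrete_right]
  refine forall_congr' fun x => ⟨fun h => (isOpen_discrete {x}).preimage h, fun h => ?_⟩
  rw [continuous_discrete_rng]
  intro y
  rw [isOpen_iff_mem_nhds]
  intro g hg
  have h1 : (fun k : G => g⁻¹ * k) ⁻¹' {k : G | X.ρ k x = x} ∈ nhds g :=
    (h.preimage (continuous_const_mul g⁻¹)).mem_nhds (by simp)
  refine Filter.mem_of_superset h1 fun k hk => ?_
  have hk' : X.ρ (g⁻¹ * k) x = x := hk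
  have hg' : X.ρ g x = y := hg
  have h2 : X.ρ (g * (g⁻¹ * k)) x = X.ρ g (X.ρ (g⁻¹ * k) x) := by
    rw [map_mul]; rfl
  rw [hk', hg', mul_inv_cancel_left] at h2
  exact h2

end Cont

/-! ### Amalgamation, joint embedding, and the atomic topology -/

section Site

variable (C : Type u₁) [Category.{v} C]

/-- The amalgamation property. -/
def AmalgamationProperty : Prop :=
  ∀ ⦃a b c : C⦄ (f : a ⟶ b) (g : a ⟶ c),
    ∃ (d : C) (f' : b ⟶ d) (g' : c ⟶ d), f ≫ f' = g ≫ g'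

/-- The joint embedding property. -/
def JointEmbeddingProperty : Prop :=
  ∀ a b : C, ∃ c : C, Nonempty (a ⟶ c) ∧ Nonempty (b ⟶ c)

variable {C}

theorem AmalgamationProperty.rightOreCondition_op (h : AmalgamationProperty C) :
    GrothendieckTopology.RightOreCondition Cᵒᵖ := by
  intro X Y Z f g
  obtain ⟨d, f', g', e⟩ := h f.unop g.unop
  exact ⟨op d, f'.op, g'.op, Quiver.Hom.unop_inj e⟩

/-- The atomic topology on `Cᵒᵖ`: the covering sieves are the non-empty ones. -/
def atomicTopology (h : AmalgamationProperty C) : GrothendieckTopology Cᵒᵖ :=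
  GrothendieckTopology.atomic h.rightOreCondition_op

end Site

/-! ### Universal and ultrahomogeneous objects -/

section Homogeneous

variable {C : Type u₁} [Category.{v} C] {D : Type u₂} [Category.{w} D] (i : C ⥤ D) (u : D)

/-- `u` is `C`-universal, with respect to an embedding `i : C ⥤ D`. -/
def IsUniversalObj : Prop :=
  ∀ c : C, Nonempty (i.obj c ⟶ u)

/-- `u` is `C`-ultrahomogeneous, with respect to an embedding `i : C ⥤ D`. -/
def IsUltrahomogeneousObj : Prop :=
  ∀ ⦃a b : C⦄ (j : a ⟶ b) (χ₁ : i.obj a ⟶ u) (χ₂ : i.obj b ⟶ u),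
    ∃ e : u ≅ u, χ₁ ≫ e.hom = i.map j ≫ χ₂

variable {u}

/-- The subgroup of the automorphisms `f` of `u` with `f ∘ χ = χ`. -/
def stab {x : D} (χ : x ⟶ u) : Subgroup (Aut u) where
  carrier := {f | χ ≫ f.hom = χ}
  one_mem' := Category.comp_id χ
  mul_mem' {f g} hf hg := by
    change χ ≫ g.hom ≫ f.hom = χ
    have hf' : χ ≫ f.hom = χ := hf
    have hg' : χ ≫ g.hom = χ := hg
    rw [← Category.assoc, hg', hf']
  inv_mem' {f} hf := by
    change χ ≫ f.inv = χ
    exact (Iso.comp_inv_eq (show u ≅ u from f)).2 (show χ ≫ f.hom = χ from hf).symm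

variable (u)

/-- The collection of the stabilizers of all arrows `χ : c ⟶ u` from objects `c` of `C`. -/
def stabilizers : Set (Subgroup (Aut u)) :=
  {H | ∃ (c : C) (χ : i.obj c ⟶ u), H = stab χ}

/-- The functor from `Cᵒᵖ` to `Aut u`-sets sending `c` to `Hom(c, u)`, on which an automorphism
`g` of `u` acts by `χ ↦ g ∘ χ`, and sending `f : c ⟶ d` to `- ∘ f : Hom(d, u) → Hom(c, u)`. -/
def homAction : Cᵒᵖ ⥤ Action (Type w) (Aut u) where
  obj c :=
    { V := i.obj c.unop ⟶ u
      ρ :=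
        { toFun := fun g => TypeCat.ofHom fun χ : i.obj c.unop ⟶ u => χ ≫ g.hom
          map_one' := by
            refine ConcreteCategory.hom_ext (C := Type w) _ _ fun χ => ?_
            exact Category.comp_id χ
          map_mul' := fun g h => by
            refine ConcreteCategory.hom_ext (C := Type w) _ _ fun χ => ?_
            exact (Category.assoc χ h.hom g.hom).symm } }
  map f :=
    { hom := TypeCat.ofHom fun χ => i.map f.unop ≫ χ
      comm := fun g => by
        ext χ
        exact (Category.assoc (i.map f.unop) χ g.hom).symm }
  map_id c := by
    ext χ
    change i.map (𝟙 c.unop) ≫ χ = χ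
    simp
  map_comp f g := by
    ext χ
    change i.map (g.unop ≫ f.unop) ≫ χ = i.map g.unop ≫ i.map f.unop ≫ χ
    simp

/-- The functor `c ↦ Hom(c, u)` with values in the continuous actions of `Aut u`, when the
stabilizers form an algebraic base and `Aut u` carries the topology that they generate. -/
def homCont (h : IsAlgebraicBase (stabilizers i u)) :
    letI := h.topology
    Cᵒᵖ ⥤ Cont (Aut u) :=
  letI := h.topology
  (IsContinuousAction (Aut u)).lift (homAction i u) fun c => by
    have := h.isTopologicalGroup
    exact (isContinuousAction_iff _).2 fun χ => h.isOpen (U := stab χ) ⟨c.unop, χ, rfl⟩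

end Homogeneous

end GaloisTopos

namespace GaloisTopos

/-! Write $G$ for the automorphism group of $u$ and $F(c)=\mathrm{Hom}(c,u)$. The inverse
equivalence is the nerve $X\mapsto\mathrm{Hom}_G(F(-),X)$ (`homSheaf`). Ultrahomogeneity makes
$F(c)$ a copy of $G/\mathcal I_\chi$, so maps $F(c)\to X$ are the points of $X$ fixed by $\mathcal
I_\chi$. By continuity every point of $X$ arises so, and since arrows to $u$ form a filtered
category, any two points arise from a common $F(c)$. Hence the nerve is fully faithful. For
essential surjectivity, let $G$ act on the stalk of a sheaf $P$, the colimit of $P(c)$ over the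
arrows $c\to u$. The map $P(c)\to\mathrm{Hom}_G(F(c),\mathrm{Stalk})$ is injective because
restrictions of an atomic sheaf are injective (`germ_injective`), and surjective because a germ
fixed by $\mathcal I_\chi$ descends to a section over $c$ (`exists_germ_eq_of_stab_fixing`).
Sheafification followed by the equivalence is left adjoint to the presheaf-valued nerve, so on
representables it is $F$ (`nonempty_yoneda_comp_iso`). -/

theorem aut_hom_inv_id {D : Type u₂} [Category.{w} D] {u : D} (g : Aut u) :
    g.hom ≫ g.inv = 𝟙 u :=
  Iso.hom_inv_id (show u ≅ u from g)

/-! ### Filteredness of the arrows to `u`, and the algebraic base -/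

section Factorization

variable {C : Type u₁} [Category.{v} C] {D : Type u₂} [Category.{w} D] {i : C ⥤ D} {u : D}
  [IsFiltered (CostructuredArrow i u)]

theorem exists_common_factorization {c d : C} (χ : i.obj c ⟶ u) (ξ : i.obj d ⟶ u) :
    ∃ (e : C) (a : c ⟶ e) (b : d ⟶ e) (ε : i.obj e ⟶ u),
      i.map a ≫ ε = χ ∧ i.map b ≫ ε = ξ := by
  let x := CostructuredArrow.mk χ
  let y := CostructuredArrow.mk ξ
  exact ⟨_, (IsFiltered.leftToMax x y).left, (IsFiltered.rightToMax x y).left,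
    (IsFiltered.max x y).hom, CostructuredArrow.w (IsFiltered.leftToMax x y),
    CostructuredArrow.w (IsFiltered.rightToMax x y)⟩

theorem exists_coequalizing {c e : C} (f g : c ⟶ e) (ε : i.obj e ⟶ u)
    (h : i.map f ≫ ε = i.map g ≫ ε) :
    ∃ (e' : C) (k : e ⟶ e') (ε' : i.obj e' ⟶ u), i.map k ≫ ε' = ε ∧ f ≫ k = g ≫ k := by
  let x := CostructuredArrow.mk (i.map f ≫ ε)
  let y := CostructuredArrow.mk ε
  let f' : x ⟶ y := CostructuredArrow.homMk f rfl
  let g' : x ⟶ y := CostructuredArrow.homMk g h.symm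
  exact ⟨_, (IsFiltered.coeqHom f' g').left, (IsFiltered.coeq f' g').hom,
    CostructuredArrow.w (IsFiltered.coeqHom f' g'),
    congrArg CommaMorphism.left (IsFiltered.coeq_condition f' g')⟩

theorem exists_cospan {c d d' : C} (f : c ⟶ d) (g : c ⟶ d') (ξ : i.obj d ⟶ u)
    (ξ' : i.obj d' ⟶ u) (h : i.map f ≫ ξ = i.map g ≫ ξ') :
    ∃ (e : C) (a : d ⟶ e) (b : d' ⟶ e) (ε : i.obj e ⟶ u),
      i.map a ≫ ε = ξ ∧ i.map b ≫ ε = ξ' ∧ f ≫ a = g ≫ b := by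
  obtain ⟨e, a, b, ε, rfl, rfl⟩ := exists_common_factorization ξ ξ'
  obtain ⟨e', k, ε', rfl, hk⟩ := exists_coequalizing (f ≫ a) (g ≫ b) ε (by simpa using h)
  exact ⟨e', a ≫ k, b ≫ k, ε', by simp, by simp, by simpa using hk⟩

variable (i u)

theorem isAlgebraicBase_stabilizers : IsAlgebraicBase (stabilizers i u) where
  nonempty := by
    obtain ⟨x⟩ := IsFiltered.nonempty (C := CostructuredArrow i u)
    exact ⟨_, x.left, x.hom, rfl⟩
  inter := by
    rintro _ ⟨c, χ, rfl⟩ _ ⟨d, ξ, rfl⟩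
    obtain ⟨e, a, b, ε, rfl, rfl⟩ := exists_common_factorization χ ξ
    refine ⟨_, ⟨e, ε, rfl⟩, fun g (hg : ε ≫ g.hom = ε) => ⟨?_, ?_⟩⟩
    · change (i.map a ≫ ε) ≫ g.hom = i.map a ≫ ε
      rw [Category.assoc, hg]
    · change (i.map b ≫ ε) ≫ g.hom = i.map b ≫ ε
      rw [Category.assoc, hg]
  conj := by
    rintro _ ⟨c, χ, rfl⟩ g
    -- Conjugating the stabilizer of `χ` by `g` gives the stabilizer of the translate $g\circ\chi$.
    refine ⟨c, χ ≫ g.hom, ?_⟩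
    ext k
    constructor
    · rintro ⟨l, hl : χ ≫ l.hom = χ, rfl⟩
      change (χ ≫ g.hom) ≫ g.inv ≫ l.hom ≫ g.hom = χ ≫ g.hom
      rw [Category.assoc, reassoc_of% aut_hom_inv_id g, reassoc_of% hl]
    · intro (hk : (χ ≫ g.hom) ≫ k.hom = χ ≫ g.hom)
      refine ⟨g⁻¹ * k * g, ?_, by simp [mul_assoc]⟩
      change χ ≫ g.hom ≫ k.hom ≫ g.inv = χ
      rw [Category.assoc] at hk
      rw [reassoc_of% hk, aut_hom_inv_id, Category.comp_id]

end Factorization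

/-! ### Consequences of ultrahomogeneity -/

section Homogeneous

variable {C : Type u₁} [Category.{v} C] {D : Type u₂} [Category.{w} D] {i : C ⥤ D} {u : D}

theorem IsUltrahomogeneousObj.exists_aut (hhom : IsUltrahomogeneousObj i u) {c : C}
    (χ ξ : i.obj c ⟶ u) : ∃ g : Aut u, χ ≫ g.hom = ξ := by
  obtain ⟨e, he⟩ := hhom (𝟙 c) χ ξ
  exact ⟨e, by simpa using he⟩

/-- Universality gives some arrow `d ⟶ u`; homogeneity then corrects it by an automorphism so that
it restricts to `χ`. -/
theorem IsUltrahomogeneousObj.exists_extension (hhom : IsUltrahomogeneousObj i u)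
    (huniv : IsUniversalObj i u) {c d : C} (f : c ⟶ d) (χ : i.obj c ⟶ u) :
    ∃ ξ : i.obj d ⟶ u, i.map f ≫ ξ = χ := by
  obtain ⟨ξ⟩ := huniv d
  obtain ⟨e, he⟩ := hhom f χ ξ
  exact ⟨ξ ≫ e.inv, by rw [← Category.assoc, ← he]; simp⟩

end Homogeneous

/-! ### Equivariant maps out of `Hom(c, u)` -/

section HomCont

variable {C : Type v} [SmallCategory C] {D : Type u₂} [Category.{v} D] {i : C ⥤ D} {u : D}
  (hB : IsAlgebraicBase (stabilizers i u))

/-- The continuous actions of the automorphism group of `u`, with the topology generated by the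
stabilizers. -/
abbrev ContAut : Type (v + 1) :=
  letI := hB.topology
  Cont (Aut u)

variable {hB}

theorem ContAut.ρ_one (X : ContAut hB) (x : X.obj.V) : X.obj.ρ 1 x = x := by
  rw [map_one]; rfl

theorem ContAut.ρ_mul (X : ContAut hB) (g h : Aut u) (x : X.obj.V) :
    X.obj.ρ (g * h) x = X.obj.ρ g (X.obj.ρ h x) := by
  rw [map_mul]; rfl

theorem ContAut.exists_stab_fixing (X : ContAut hB) (x : X.obj.V) :
    ∃ (c : C) (χ : i.obj c ⟶ u), ∀ g ∈ stab χ, X.obj.ρ g x = x := by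
  let := hB.topology
  have := hB.isTopologicalGroup
  have hx := ((isContinuousAction_iff X.obj).1 X.property x).mem_nhds (ContAut.ρ_one X x)
  obtain ⟨_, ⟨c, χ, rfl⟩, h⟩ := hB.hasBasis_nhds_one.mem_iff.1 hx
  exact ⟨c, χ, fun g hg => h hg⟩

/-- The continuous action underlying an action whose points are all fixed by some stabilizer. -/
def ContAut.mk (X : Action (Type v) (Aut u))
    (h : ∀ x : X.V, ∃ (c : C) (χ : i.obj c ⟶ u), ∀ g ∈ stab χ, X.ρ g x = x) : ContAut hB :=
  letI := hB.topology
  { obj := X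
    property := by
      have := hB.isTopologicalGroup
      refine (isContinuousAction_iff X).2 fun x => ?_
      obtain ⟨c, χ, hχ⟩ := h x
      let S : Subgroup (Aut u) :=
        { carrier := {g | X.ρ g x = x}
          one_mem' := by
            change X.ρ 1 x = x
            rw [map_one]; rfl
          mul_mem' := fun {g k} (hg : X.ρ g x = x) (hk : X.ρ k x = x) => by
            change X.ρ (g * k) x = x
            rw [map_mul]
            change X.ρ g (X.ρ k x) = x
            rw [hk, hg]
          inv_mem' := fun {g} (hg : X.ρ g x = x) => by
            change X.ρ g⁻¹ x = x
            conv_lhs => rw [← hg]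
            change (X.ρ g⁻¹ * X.ρ g) x = x
            rw [← map_mul, inv_mul_cancel, map_one]; rfl }
      -- A subgroup containing an open subgroup is open.
      exact Subgroup.isOpen_mono (H₁ := stab χ) (H₂ := S) hχ (hB.isOpen ⟨c, χ, rfl⟩) }

/-- The value at `χ : c ⟶ u` of an equivariant map from `Hom(c, u)`. -/
def homContValue {c : C} {X : ContAut hB} (m : (homCont i u hB).obj (op c) ⟶ X)
    (χ : i.obj c ⟶ u) : X.obj.V :=
  m.hom.hom χ

theorem homContValue_comp_aut {c : C} {X : ContAut hB} (m : (homCont i u hB).obj (op c) ⟶ X)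
    (χ : i.obj c ⟶ u) (g : Aut u) :
    homContValue m (χ ≫ g.hom) = X.obj.ρ g (homContValue m χ) :=
  ConcreteCategory.congr_hom (m.hom.comm g) χ

theorem homContValue_map {c d : C} {X : ContAut hB} (m : (homCont i u hB).obj (op c) ⟶ X)
    (f : c ⟶ d) (ξ : i.obj d ⟶ u) :
    homContValue ((homCont i u hB).map f.op ≫ m) ξ = homContValue m (i.map f ≫ ξ) :=
  rfl

theorem homCont_hom_ext {c : C} {X : ContAut hB} {m n : (homCont i u hB).obj (op c) ⟶ X}
    (h : ∀ χ, homContValue m χ = homContValue n χ) : m = n := by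
  refine ObjectProperty.hom_ext _ (Action.hom_ext _ _ ?_)
  exact ConcreteCategory.hom_ext (C := Type v) _ _ h

/-- The morphism of continuous actions given by an equivariant map. -/
def ContAut.homMk {X Y : ContAut hB} (φ : X.obj.V → Y.obj.V)
    (h : ∀ (g : Aut u) (x : X.obj.V), φ (X.obj.ρ g x) = Y.obj.ρ g (φ x)) : X ⟶ Y :=
  ObjectProperty.homMk
    { hom := TypeCat.ofHom φ
      comm := fun g => ConcreteCategory.hom_ext (C := Type v) _ _ (h g) }

/-- The morphism from `Hom(c, u)` given by an equivariant map. -/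
def homContMk {c : C} {X : ContAut hB} (φ : (i.obj c ⟶ u) → X.obj.V)
    (h : ∀ (χ : i.obj c ⟶ u) (g : Aut u), φ (χ ≫ g.hom) = X.obj.ρ g (φ χ)) :
    (homCont i u hB).obj (op c) ⟶ X :=
  ContAut.homMk φ fun g χ => h χ g

@[simp]
theorem homContValue_homContMk {c : C} {X : ContAut hB} (φ : (i.obj c ⟶ u) → X.obj.V)
    (h : ∀ (χ : i.obj c ⟶ u) (g : Aut u), φ (χ ≫ g.hom) = X.obj.ρ g (φ χ)) (χ : i.obj c ⟶ u) :
    homContValue (homContMk φ h) χ = φ χ :=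
  rfl

theorem IsUltrahomogeneousObj.homCont_hom_ext (hhom : IsUltrahomogeneousObj i u) {c : C}
    {X : ContAut hB} {m n : (homCont i u hB).obj (op c) ⟶ X} (χ : i.obj c ⟶ u)
    (h : homContValue m χ = homContValue n χ) : m = n := by
  refine GaloisTopos.homCont_hom_ext fun ξ => ?_
  obtain ⟨g, rfl⟩ := hhom.exists_aut χ ξ
  rw [homContValue_comp_aut, homContValue_comp_aut, h]

/-- A point fixed by the stabilizer of `χ` is the value at `χ` of an equivariant map. -/
theorem IsUltrahomogeneousObj.exists_homContValue_eq (hhom : IsUltrahomogeneousObj i u)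
    {X : ContAut hB} {c : C} (χ : i.obj c ⟶ u) (x : X.obj.V)
    (hx : ∀ g ∈ stab χ, X.obj.ρ g x = x) :
    ∃ m : (homCont i u hB).obj (op c) ⟶ X, homContValue m χ = x := by
  choose γ hγ using hhom.exists_aut χ
  -- The point $g\cdot x$ depends only on $g\circ\chi$, so the choice of `γ` is immaterial.
  have key (g h : Aut u) (e : χ ≫ g.hom = χ ≫ h.hom) : X.obj.ρ g x = X.obj.ρ h x := by
    have : h⁻¹ * g ∈ stab χ := by
      change χ ≫ g.hom ≫ h.inv = χ
      rw [reassoc_of% e, aut_hom_inv_id, Category.comp_id]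
    conv_rhs => rw [← hx _ this]
    rw [← ContAut.ρ_mul, mul_inv_cancel_left]
  refine ⟨homContMk (fun ξ => X.obj.ρ (γ ξ) x) fun ξ g => ?_, ?_⟩
  · rw [← ContAut.ρ_mul]
    refine key _ _ ?_
    change _ = χ ≫ (γ ξ).hom ≫ g.hom
    rw [hγ, reassoc_of% hγ ξ]
  · rw [homContValue_homContMk, key (γ χ) 1, ContAut.ρ_one]
    rw [hγ]
    exact (Category.comp_id χ).symm

end HomCont

/-! ### The nerve: sheaf condition, faithfulness, fullness -/

section HomSheaf

variable {C : Type v} [SmallCategory C] {D : Type u₂} [Category.{v} D] {i : C ⥤ D} {u : D}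
  (hB : IsAlgebraicBase (stabilizers i u))

/-- The functor sending a continuous action `X` to the presheaf of equivariant maps
`Hom(c, u) ⟶ X`. -/
def homPresheaf : ContAut hB ⥤ (Cᵒᵖ)ᵒᵖ ⥤ Type v :=
  yoneda ⋙ (Functor.whiskeringLeft _ _ _).obj (homCont i u hB).op

variable {hB}

/-- A single arrow `f` of the covering sieve determines the glued map: its value at `χ` is read off
at any extension of `χ` along `f`. -/
theorem isSheaf_homPresheaf [IsFiltered (CostructuredArrow i u)] (hAP : AmalgamationProperty C)
    (huniv : IsUniversalObj i u) (hhom : IsUltrahomogeneousObj i u) (X : ContAut hB) :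
    Presieve.IsSheaf (atomicTopology hAP) ((homPresheaf hB).obj X) := by
  rintro ⟨c⟩ S ⟨⟨d⟩, f, hf⟩ x hx
  obtain ⟨f, rfl⟩ : ∃ k : c ⟶ d, f = k.op := ⟨f.unop, rfl⟩
  let y {d : C} (f : c ⟶ d) (hf : S f.op) : (homCont i u hB).obj (op d) ⟶ X := x f.op hf
  -- The value depends neither on the arrow of the sieve nor on the extension: two choices meet over
  -- a cospan, where the family is compatible.
  have key {d d' : C} (f : c ⟶ d) (g : c ⟶ d') (hf : S f.op) (hg : S g.op)
      (ξ : i.obj d ⟶ u) (ξ' : i.obj d' ⟶ u) (h : i.map f ≫ ξ = i.map g ≫ ξ') :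
      homContValue (y f hf) ξ = homContValue (y g hg) ξ' := by
    obtain ⟨e, a, b, ε, rfl, rfl, hab⟩ := exists_cospan f g ξ ξ' h
    have := hx a.op b.op hf hg (by rw [← op_comp, ← op_comp, hab])
    exact congrArg (fun m => homContValue (c := e) m ε) this
  choose ext hext using hhom.exists_extension huniv f
  let m : (homCont i u hB).obj (op c) ⟶ X :=
    homContMk (fun χ => homContValue (y f hf) (ext χ)) fun χ g => by
      rw [← homContValue_comp_aut]
      refine key f f hf hf _ _ ?_
      rw [hext, reassoc_of% hext χ]
  refine ⟨m, ?_, ?_⟩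
  · rintro ⟨d'⟩ g hg
    obtain ⟨g, rfl⟩ : ∃ k : c ⟶ d', g = k.op := ⟨g.unop, rfl⟩
    exact homCont_hom_ext fun ξ => key f g hf hg _ _ (hext _)
  · intro (m' : (homCont i u hB).obj (op c) ⟶ X) hm'
    refine homCont_hom_ext fun χ => ?_
    have : homContValue ((homCont i u hB).map f.op ≫ m') (ext χ) =
        homContValue (y f hf) (ext χ) := congrArg (fun m => homContValue m (ext χ)) (hm' _ hf)
    rw [homContValue_map, hext] at this
    exact this

theorem ContAut.exists_value_eq (hhom : IsUltrahomogeneousObj i u) (X : ContAut hB) (x : X.obj.V) :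
    ∃ (c : C) (χ : i.obj c ⟶ u) (m : (homCont i u hB).obj (op c) ⟶ X),
      homContValue m χ = x := by
  obtain ⟨c, χ, h⟩ := X.exists_stab_fixing x
  exact ⟨c, χ, hhom.exists_homContValue_eq χ x h⟩

variable [IsFiltered (CostructuredArrow i u)] (hAP : AmalgamationProperty C)
  (huniv : IsUniversalObj i u) (hhom : IsUltrahomogeneousObj i u)

/-- The functor sending a continuous action `X` to the sheaf of equivariant maps
`Hom(c, u) ⟶ X`. -/
def homSheaf : ContAut hB ⥤ Sheaf (atomicTopology hAP) (Type v) :=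
  ObjectProperty.lift _ (homPresheaf hB) fun X =>
    (isSheaf_iff_isSheaf_of_type _ _).2 (isSheaf_homPresheaf hAP huniv hhom X)

theorem faithful_homSheaf : (homSheaf (hB := hB) hAP huniv hhom).Faithful where
  map_injective {X Y φ ψ} h := by
    refine ObjectProperty.hom_ext _ (Action.hom_ext _ _ ?_)
    refine ConcreteCategory.hom_ext (C := Type v) _ _ fun x => ?_
    obtain ⟨c, χ, m, rfl⟩ := X.exists_value_eq hhom x
    have := ConcreteCategory.congr_hom
      (congrArg (fun k => NatTrans.app (InducedCategory.Hom.hom k) (op (op c))) h) m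
    exact congrArg (fun k => homContValue (c := c) k χ) this

theorem full_homSheaf : (homSheaf (hB := hB) hAP huniv hhom).Full where
  map_surjective {X Y} α := by
    let β {c : C} (m : (homCont i u hB).obj (op c) ⟶ X) : (homCont i u hB).obj (op c) ⟶ Y :=
      α.hom.app (op (op c)) m
    have hβ {c d : C} (f : c ⟶ d) (m : (homCont i u hB).obj (op c) ⟶ X) :
        β ((homCont i u hB).map f.op ≫ m) = (homCont i u hB).map f.op ≫ β m :=
      ConcreteCategory.congr_hom (α.hom.naturality f.op.op) m
    choose c χ m hm using X.exists_value_eq hhom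
    -- The image of a point does not depend on its presentation: over a common refinement the two
    -- maps agree at `ε`, hence everywhere by transitivity.
    have key {a b : C} (k : (homCont i u hB).obj (op a) ⟶ X)
        (l : (homCont i u hB).obj (op b) ⟶ X) (ξ : i.obj a ⟶ u) (ζ : i.obj b ⟶ u)
        (h : homContValue k ξ = homContValue l ζ) :
        homContValue (β k) ξ = homContValue (β l) ζ := by
      obtain ⟨e, f, g, ε, rfl, rfl⟩ := exists_common_factorization ξ ζ
      rw [← homContValue_map, ← homContValue_map, ← hβ, ← hβ,
        hhom.homCont_hom_ext (m := (homCont i u hB).map f.op ≫ k)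
          (n := (homCont i u hB).map g.op ≫ l) ε h]
    refine ⟨ContAut.homMk (fun x => homContValue (β (m x)) (χ x)) fun g x => ?_, ?_⟩
    · rw [← homContValue_comp_aut]
      refine key _ _ _ _ ?_
      rw [hm, homContValue_comp_aut, hm]
    · refine ObjectProperty.hom_ext _ (NatTrans.ext (funext fun c' => ?_))
      refine ConcreteCategory.hom_ext (C := Type v) _ _ fun k => ?_
      exact homCont_hom_ext fun ξ => key _ _ _ _ (hm _)

end HomSheaf

/-! ### The stalk at `u` and its action -/

section Stalk

variable {C : Type v} [SmallCategory C]

/-- One arrow already generates a covering sieve of the atomic topology, and a sheaf is separated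
for it. -/
theorem injective_map_of_isSheaf {P : (Cᵒᵖ)ᵒᵖ ⥤ Type v} {hAP : AmalgamationProperty C}
    (hP : Presieve.IsSheaf (atomicTopology hAP) P) {c d : C} (f : c ⟶ d) :
    Function.Injective (P.map f.op.op) := by
  intro p q h
  refine (hP (Sieve.generate (Presieve.singleton f.op))
    ⟨_, f.op, Sieve.le_generate _ _ _ .mk⟩).isSeparatedFor.ext ?_
  rintro _ _ ⟨_, k, _, ⟨⟩, rfl⟩
  rw [op_comp, P.map_comp]
  exact congrArg (P.map k.op) h

variable {D : Type u₂} [Category.{v} D] (i : C ⥤ D) (u : D)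
  [IsFiltered (CostructuredArrow i u)] (P : (Cᵒᵖ)ᵒᵖ ⥤ Type v)

/-- The germs of `P` along arrows to `u`, before identification. -/
structure PreStalk where
  obj : C
  arrow : i.obj obj ⟶ u
  sec : P.obj (op (op obj))

variable {i u P} in
/-- Two germs agree if they agree after refinement along an arrow to `u`. -/
def PreStalk.Rel (x y : PreStalk i u P) : Prop :=
  ∃ (e : C) (a : x.obj ⟶ e) (b : y.obj ⟶ e) (ε : i.obj e ⟶ u),
    i.map a ≫ ε = x.arrow ∧ i.map b ≫ ε = y.arrow ∧
      P.map a.op.op x.sec = P.map b.op.op y.sec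

theorem map_op_op_comp {c d e : C} (f : c ⟶ d) (g : d ⟶ e) (p : P.obj (op (op c))) :
    P.map (f ≫ g).op.op p = P.map g.op.op (P.map f.op.op p) := by
  rw [op_comp, op_comp, P.map_comp]; rfl

/-- The setoid of germs of `P` along arrows to `u`. -/
def stalkSetoid : Setoid (PreStalk i u P) where
  r := PreStalk.Rel
  iseqv :=
    { refl := fun x => ⟨x.obj, 𝟙 _, 𝟙 _, x.arrow, by simp, by simp, rfl⟩
      symm := fun ⟨e, a, b, ε, ha, hb, h⟩ => ⟨e, b, a, ε, hb, ha, h.symm⟩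
      trans := by
        rintro x y z ⟨e, a, b, ε, ha, hb, h⟩ ⟨e', a', b', ε', ha', hb', h'⟩
        obtain ⟨k, s, t, κ, rfl, rfl, hst⟩ := exists_cospan b a' ε ε' (hb.trans ha'.symm)
        refine ⟨k, a ≫ s, b' ≫ t, κ, by simpa using ha, by simpa using hb', ?_⟩
        rw [map_op_op_comp, map_op_op_comp, h, ← h', ← map_op_op_comp, ← map_op_op_comp, hst] }

/-- The stalk of `P` at `u`. -/
def Stalk : Type v := Quotient (stalkSetoid i u P)

variable {i u}

/-- The germ of a section along an arrow to `u`. -/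
def germ {c : C} (χ : i.obj c ⟶ u) (p : P.obj (op (op c))) : Stalk i u P :=
  Quotient.mk (stalkSetoid i u P) ⟨c, χ, p⟩

theorem germ_eq_iff {c d : C} (χ : i.obj c ⟶ u) (ξ : i.obj d ⟶ u) (p : P.obj (op (op c)))
    (q : P.obj (op (op d))) :
    germ P χ p = germ P ξ q ↔ ∃ (e : C) (a : c ⟶ e) (b : d ⟶ e) (ε : i.obj e ⟶ u),
      i.map a ≫ ε = χ ∧ i.map b ≫ ε = ξ ∧ P.map a.op.op p = P.map b.op.op q :=
  ⟨fun h => Quotient.exact h, fun h => Quotient.sound h⟩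

theorem germ_map {c d : C} (f : c ⟶ d) (ξ : i.obj d ⟶ u) (p : P.obj (op (op c))) :
    germ P ξ (P.map f.op.op p) = germ P (i.map f ≫ ξ) p :=
  (germ_eq_iff P _ _ _ _).2 ⟨d, 𝟙 d, f, ξ, by simp, rfl, by rw [← map_op_op_comp]; simp⟩

variable {P} in
theorem exists_germ_eq (x : Stalk i u P) :
    ∃ (c : C) (χ : i.obj c ⟶ u) (p : P.obj (op (op c))), germ P χ p = x := by
  obtain ⟨⟨c, χ, p⟩, rfl⟩ := Quotient.exists_rep x
  exact ⟨c, χ, p, rfl⟩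

variable {P} in
/-- The action of an automorphism of `u` on the stalk. -/
def stalkMap (g : Aut u) : Stalk i u P → Stalk i u P :=
  Quotient.lift (fun x => germ P (x.arrow ≫ g.hom) x.sec) fun x y ⟨e, a, b, ε, ha, hb, h⟩ =>
    (germ_eq_iff P _ _ _ _).2 ⟨e, a, b, ε ≫ g.hom, by rw [← ha, Category.assoc],
      by rw [← hb, Category.assoc], h⟩

theorem stalkMap_germ (g : Aut u) {c : C} (χ : i.obj c ⟶ u) (p : P.obj (op (op c))) :
    stalkMap g (germ P χ p) = germ P (χ ≫ g.hom) p :=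
  rfl

variable (i u)

/-- The action of the automorphism group of `u` on the stalk. -/
def stalkAction : Action (Type v) (Aut u) where
  V := Stalk i u P
  ρ :=
    { toFun := fun g => TypeCat.ofHom (stalkMap g)
      map_one' := by
        refine ConcreteCategory.hom_ext (C := Type v) _ _ fun x => ?_
        obtain ⟨c, χ, p, rfl⟩ := exists_germ_eq x
        exact congrArg (fun k => germ P k p) (Category.comp_id χ)
      map_mul' := fun g h => by
        refine ConcreteCategory.hom_ext (C := Type v) _ _ fun x => ?_
        obtain ⟨c, χ, p, rfl⟩ := exists_germ_eq x
        exact congrArg (fun k => germ P k p) (Category.assoc χ h.hom g.hom).symm }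

/-- The stalk as a continuous action. -/
def stalkCont (hB : IsAlgebraicBase (stabilizers i u)) : ContAut hB :=
  ContAut.mk (stalkAction i u P) fun x => by
    obtain ⟨c, χ, p, rfl⟩ := exists_germ_eq x
    refine ⟨c, χ, fun g hg => ?_⟩
    exact congrArg (fun k => germ P k p) hg

variable (hB : IsAlgebraicBase (stabilizers i u))

/-- The equivariant map `χ ↦ germ χ p` defined by a section `p`. -/
def sectionHom {c : C} (p : P.obj (op (op c))) :
    (homCont i u hB).obj (op c) ⟶ stalkCont i u P hB :=
  homContMk (fun χ => (germ P χ p : Stalk i u P)) fun _ _ => rfl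

/-- The comparison of a presheaf with the equivariant maps to its stalk. -/
def toHomPresheaf : P ⟶ (homPresheaf hB).obj (stalkCont i u P hB) where
  app c := TypeCat.ofHom fun p => sectionHom i u P hB (c := c.unop.unop) p
  naturality c d f := by
    refine ConcreteCategory.hom_ext (C := Type v) _ _ fun p => ?_
    exact homCont_hom_ext fun χ => germ_map P f.unop.unop χ p

variable {i u P} {hAP : AmalgamationProperty C}

theorem germ_injective (hP : Presieve.IsSheaf (atomicTopology hAP) P) {c : C}
    (χ : i.obj c ⟶ u) : Function.Injective (germ P χ) := by
  intro p q h
  obtain ⟨e, a, b, ε, ha, hb, h⟩ := (germ_eq_iff P _ _ _ _).1 h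
  -- The sections agree after restriction along the possibly different `a` and `b`; coequalizing
  -- these leaves a single restriction, which is injective.
  obtain ⟨e', k, ε', -, hk⟩ := exists_coequalizing a b ε (ha.trans hb.symm)
  refine injective_map_of_isSheaf hP (a ≫ k) ?_
  conv_rhs => rw [hk]
  rw [map_op_op_comp, map_op_op_comp, h]

/-- Represent `x` by a section `q` over some `k : c ⟶ d` through which `χ` factors. Invariance under
the stabilizer of `χ` is what makes `q` a matching family for the cover generated by `k`. -/
theorem exists_germ_eq_of_stab_fixing (hP : Presieve.IsSheaf (atomicTopology hAP) P)
    (huniv : IsUniversalObj i u) (hhom : IsUltrahomogeneousObj i u) {c : C}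
    (χ : i.obj c ⟶ u) (x : Stalk i u P) (hx : ∀ g ∈ stab χ, stalkMap g x = x) :
    ∃ p, germ P χ p = x := by
  obtain ⟨d₀, ξ₀, q₀, rfl⟩ := exists_germ_eq x
  obtain ⟨d, k, b, ξ, rfl, rfl⟩ := exists_common_factorization χ ξ₀
  obtain ⟨q, hq⟩ : ∃ q, q = P.map b.op.op q₀ := ⟨_, rfl⟩
  rw [← germ_map, ← hq] at hx ⊢
  have key {e : C} (f g : d ⟶ e) (h : k ≫ f = k ≫ g) :
      P.map f.op.op q = P.map g.op.op q := by
    obtain ⟨ε⟩ := huniv e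
    -- Both `s` and `t` move `ξ`, to $\varepsilon\circ f$ and $\varepsilon\circ g$. They agree on
    -- `χ`, so $t^{-1}s$ fixes `x`, and the germs along `ε` of the two restrictions of `q` coincide.
    obtain ⟨s, hs⟩ := hhom.exists_aut ξ (i.map f ≫ ε)
    obtain ⟨t, ht⟩ := hhom.exists_aut ξ (i.map g ≫ ε)
    have hst : t⁻¹ * s ∈ stab (i.map k ≫ ξ) := by
      change (i.map k ≫ ξ) ≫ s.hom ≫ t.inv = i.map k ≫ ξ
      rw [Category.assoc, reassoc_of% hs, ← Functor.map_comp_assoc, h, Functor.map_comp_assoc,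
        ← reassoc_of% ht, aut_hom_inv_id, Category.comp_id]
    refine germ_injective hP ε ?_
    rw [germ_map, germ_map, ← hs, ← ht, ← stalkMap_germ, ← stalkMap_germ]
    conv_rhs => rw [← hx _ hst]
    rw [stalkMap_germ, stalkMap_germ, stalkMap_germ, Category.assoc]
    congr 1
    change ξ ≫ s.hom = ξ ≫ (s.hom ≫ t.inv) ≫ t.hom
    rw [Category.assoc, show t.inv ≫ t.hom = 𝟙 u from Iso.inv_hom_id (show u ≅ u from t),
      Category.comp_id]
  have hS : Sieve.generate (Presieve.singleton k.op) ∈ atomicTopology hAP (op c) :=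
    ⟨_, k.op, Sieve.le_generate _ _ _ .mk⟩
  obtain ⟨p, hp, -⟩ := hP.isSheafFor (Presieve.singleton k.op) hS
    -- The presieve has the single member `k.op`, with section `q`; `eqToHom` only transports along
    -- the equality of objects.
    (fun _ f hf => P.map (eqToHom (by cases hf; rfl)) q) (by
      rintro _ _ e f g _ _ ⟨⟩ ⟨⟩ h
      simpa using key (e := e.unop) f.unop g.unop (congrArg Quiver.Hom.unop h))
  refine ⟨p, ?_⟩
  have := hp k.op ⟨⟩
  rw [← germ_map, this]
  simp

end Stalk

/-- Adjunction and Yoneda give $\mathrm{Hom}(L(ya),b)\cong\mathrm{Hom}(Fa,b)$, naturally in $a$ and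
$b$. -/
theorem nonempty_yoneda_comp_iso {A : Type v} [SmallCategory A] {B : Type u₂} [Category.{v} B]
    {F : A ⥤ B} {L : (Aᵒᵖ ⥤ Type v) ⥤ B}
    (adj : L ⊣ yoneda ⋙ (Functor.whiskeringLeft _ _ (Type v)).obj F.op) :
    Nonempty (yoneda ⋙ L ≅ F) := by
  let R := yoneda ⋙ (Functor.whiskeringLeft _ _ (Type v)).obj F.op
  let e (a : A) (b : B) : (F.obj a ⟶ b) ≃ (L.obj (yoneda.obj a) ⟶ b) :=
    (yonedaEquiv (F := R.obj b)).symm.trans (adj.homEquiv _ _).symm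
  have hr {a : A} {b b' : B} (m : F.obj a ⟶ b) (n : b ⟶ b') : e a b' (m ≫ n) = e a b m ≫ n := by
    refine Eq.trans ?_ (adj.homEquiv_naturality_right_symm _ _)
    refine congrArg (adj.homEquiv _ _).symm (yonedaEquiv.injective ?_)
    rw [Equiv.apply_symm_apply, yonedaEquiv_comp, Equiv.apply_symm_apply]
    rfl
  have hl {a a' : A} {b : B} (f : a ⟶ a') (m : F.obj a' ⟶ b) :
      e a b (F.map f ≫ m) = L.map (yoneda.map f) ≫ e a' b m := by
    refine Eq.trans ?_ (adj.homEquiv_naturality_left_symm _ _)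
    refine congrArg (adj.homEquiv _ _).symm (yonedaEquiv.injective ?_)
    rw [Equiv.apply_symm_apply, ← yonedaEquiv_naturality, Equiv.apply_symm_apply]
    rfl
  let τ : yoneda ⋙ L ⟶ F :=
    { app := fun a => e a _ (𝟙 _)
      naturality := fun a a' f => by
        change L.map (yoneda.map f) ≫ e a' _ (𝟙 _) = e a _ (𝟙 _) ≫ F.map f
        rw [← hl, ← hr, Category.comp_id, Category.id_comp] }
  have (a : A) : IsIso (τ.app a) := by
    rw [isIso_iff_coyoneda_map_bijective]
    intro b
    -- By naturality in $b$, precomposition with the component of `τ` is the bijection `e a b`.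
    have h : (fun m : F.obj a ⟶ b => e a _ (𝟙 _) ≫ m) = e a b := by
      funext m
      rw [← hr, Category.id_comp]
    exact h ▸ (e a b).bijective
  have : IsIso τ := NatIso.isIso_of_isIso_app τ
  exact ⟨asIso τ⟩

theorem isTransitiveAction_homCont {C : Type v} [SmallCategory C] {D : Type u₂} [Category.{v} D]
    {i : C ⥤ D} {u : D} {hB : IsAlgebraicBase (stabilizers i u)}
    (huniv : IsUniversalObj i u) (hhom : IsUltrahomogeneousObj i u) (c : Cᵒᵖ) :
    letI := hB.topology
    IsTransitiveAction ((homCont i u hB).obj c).obj :=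
  ⟨huniv c.unop, fun χ ξ => hhom.exists_aut χ ξ⟩

/-! ### Essential surjectivity and the equivalence -/

section Equivalence

variable {C : Type v} [SmallCategory C] {D : Type u₂} [Category.{v} D] {i : C ⥤ D} {u : D}
  [IsFiltered (CostructuredArrow i u)] {hB : IsAlgebraicBase (stabilizers i u)}

theorem bijective_sectionHom {P : (Cᵒᵖ)ᵒᵖ ⥤ Type v} {hAP : AmalgamationProperty C}
    (hP : Presieve.IsSheaf (atomicTopology hAP) P)
    (huniv : IsUniversalObj i u) (hhom : IsUltrahomogeneousObj i u) (c : C) :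
    Function.Bijective (sectionHom i u P hB (c := c)) := by
  obtain ⟨χ⟩ := huniv c
  refine ⟨fun p q h => germ_injective hP χ (congrArg (fun m => homContValue m χ) h), fun m => ?_⟩
  obtain ⟨p, hp⟩ := exists_germ_eq_of_stab_fixing hP huniv hhom χ (homContValue m χ) fun g hg => by
    have h := homContValue_comp_aut m χ g
    rw [show χ ≫ g.hom = χ from hg] at h
    exact h.symm
  exact ⟨p, hhom.homCont_hom_ext χ hp⟩

theorem essSurj_homSheaf (hAP : AmalgamationProperty C) (huniv : IsUniversalObj i u)
    (hhom : IsUltrahomogeneousObj i u) :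
    (homSheaf (hB := hB) hAP huniv hhom).EssSurj where
  mem_essImage := by
    rintro ⟨P, hP⟩
    have (c : (Cᵒᵖ)ᵒᵖ) : IsIso ((toHomPresheaf i u P hB).app c) :=
      (isIso_iff_bijective _).2 (bijective_sectionHom
        ((isSheaf_iff_isSheaf_of_type _ _).1 hP) huniv hhom c.unop.unop)
    have : IsIso (toHomPresheaf i u P hB) := NatIso.isIso_of_isIso_app _
    let κ := asIso (toHomPresheaf i u P hB)
    exact ⟨stalkCont i u P hB, ⟨ObjectProperty.isoMk _ κ.symm⟩⟩

theorem exists_sheaf_equivalence (hAP : AmalgamationProperty C) (huniv : IsUniversalObj i u)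
    (hhom : IsUltrahomogeneousObj i u) :
    ∃ E : Sheaf (atomicTopology hAP) (Type v) ≌ ContAut hB,
      Nonempty (yoneda ⋙ presheafToSheaf (atomicTopology hAP) (Type v) ⋙ E.functor ≅
        homCont i u hB) := by
  have := faithful_homSheaf (hB := hB) hAP huniv hhom
  have := full_homSheaf (hB := hB) hAP huniv hhom
  have := essSurj_homSheaf (hB := hB) hAP huniv hhom
  have : (homSheaf (hB := hB) hAP huniv hhom).IsEquivalence := { }
  let E := (homSheaf (hB := hB) hAP huniv hhom).asEquivalence.symm
  exact ⟨E, nonempty_yoneda_comp_iso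
    ((sheafificationAdjunction (atomicTopology hAP) (Type v)).comp E.toAdjunction)⟩

end Equivalence

end GaloisTopos

theorem theorem3p3 {C : Type v} [SmallCategory C] [Nonempty C]
    (hAP : GaloisTopos.AmalgamationProperty C) (hJEP : GaloisTopos.JointEmbeddingProperty C)
    (u : Ind C)
    (huniv : GaloisTopos.IsUniversalObj (Ind.yoneda (C := C)) u)
    (hhom : GaloisTopos.IsUltrahomogeneousObj (Ind.yoneda (C := C)) u) :
    ∃ hB : GaloisTopos.IsAlgebraicBase (GaloisTopos.stabilizers (Ind.yoneda (C := C)) u),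
      letI : TopologicalSpace (Aut u) := hB.topology
      (∀ c : Cᵒᵖ, GaloisTopos.IsTransitiveAction
        ((GaloisTopos.homCont (Ind.yoneda (C := C)) u hB).obj c).obj) ∧
      ∃ E : Sheaf (GaloisTopos.atomicTopology hAP) (Type v) ≌ GaloisTopos.Cont (Aut u),
        Nonempty (yoneda ⋙ presheafToSheaf (GaloisTopos.atomicTopology hAP) (Type v) ⋙ E.functor ≅
          GaloisTopos.homCont (Ind.yoneda (C := C)) u hB) := by
  -- This is where `u` being an ind-object enters.
  have : IsFiltered (CostructuredArrow (Ind.yoneda (C := C)) u) := RepresentablyCoflat.filtered u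
  exact ⟨GaloisTopos.isAlgebraicBase_stabilizers _ u,
    GaloisTopos.isTransitiveAction_homCont huniv hhom,
    GaloisTopos.exists_sheaf_equivalence hAP huniv hhom⟩
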